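/- Let $n\ge 2$, let $\Omega\subset\mathbb{R}^n$ be a domain (open, connected, non-empty), let $G$ be a real-valued function that is smooth on an open set $J \subset \mathbb{R}$, and let $u:\Omega\to\mathbb{R}$ be a smooth function with values in $J$ that is a convex solution of $\Delta u=G(u)$ in $\Omega$, where convex means that $u$ is convex on every convex subset of $\Omega$ (equivalently, $D^2u\ge 0$ in $\Omega$). Suppose that at every value $t=u(x)$, $x\in\Omega$, $$G(t)>0,\qquad G'(t)<0,\qquad G(t)\,G''(t)\le \frac{n}{n-1}\,\bigl(G'(t)\bigr)^2 .$$ If the function $\det D^2u$ has a local minimum at some point of $\Omega$, then $\det D^2u(x)=0$ for every $x\in\Omega$. -/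

import Mathlib

open scoped ContDiff

/-- The Hessian matrix `D²u(x)` of a function on `ℝⁿ`: its `(i, j)` entry is the second derivative
of `u` at `x` in the directions of the `i`-th and `j`-th standard basis vectors. -/
noncomputable def hessianMatrix {n : ℕ} (u : EuclideanSpace ℝ (Fin n) → ℝ)
    (x : EuclideanSpace ℝ (Fin n)) : Matrix (Fin n) (Fin n) ℝ :=
  Matrix.of fun i j =>
    iteratedFDeriv ℝ 2 u x ![EuclideanSpace.single i 1, EuclideanSpace.single j 1]

/-- Convexity of a function on a set `Ω` that need not be convex itself: the function is convex
(in the usual sense) on every convex subset of `Ω`. For convex `Ω` this is ordinary convexity on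
`Ω`; for open `Ω` and a `C²` function it says that the Hessian is positive semidefinite on `Ω`. -/
def IsConvexFunctionOn {n : ℕ} (Ω : Set (EuclideanSpace ℝ (Fin n)))
    (u : EuclideanSpace ℝ (Fin n) → ℝ) : Prop :=
  ∀ s : Set (EuclideanSpace ℝ (Fin n)), s ⊆ Ω → Convex ℝ s → ConvexOn ℝ s u

/-!
The theorem combines a pointwise computation with a strong minimum principle.

**A local minimum of `det D²u` is a zero** (`det_hessianMatrix_eq_zero_of_isLocalMin`). Suppose
`D²u(p)` is invertible and diagonalize it, with eigenvalues `λ_i > 0`. Along each coordinate line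
`det D²u` has a local minimum at `p`, which gives (`det_second_order_condition`)
`∑ i, u_iik / λ_i = 0` and `∑ i j, u_ijk² / (λ_i λ_j) ≤ ∑ i, u_iikk / λ_i`. Summing the latter over
`k` and using the twice differentiated equation, the right side becomes
`n G' + G'' ∑ i, u_i² / λ_i`. By the Cauchy-Schwarz inequality and the trace conditions
`∑ i, u_iik / λ_i = 0` and `∑ i, u_iik = G' u_k`, the left side is at least
`n / (n - 1) * G'² / G * ∑ i, u_i² / λ_i` (`symmetric_tensor_inequality`). The assumption on `G''`
then leaves `0 ≤ n G'`, which contradicts `G' < 0`.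

**A zero of `det D²u` propagates** (`not_touching_closedBall`). The determinant vanishes where the
least eigenvalue of `D²u` does. If a smooth `φ` touches that eigenvalue from below at `x` with unit
eigenvector `e`, then for each real `s` the function
`y ↦ D²u(y)(v, v) - φ(y) |v|²` with `v = e + s (y - x)` has a local minimum at `x`. Its Laplacian
there is nonnegative, and for `s = -G' u_e / G` this says `Δφ ≤ 4 (G' u_e / G) φ_e`
(`laplacian_testFunction_le`); only `G G'' ≤ 2 G'²` is used here. So the least eigenvalue is a
supersolution in the viscosity sense of a linear elliptic equation, and Hopf's barrier argument
applies: a ball in the complement of the zero set cannot touch the zero set. On a connected domain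
this forces the zero set to be empty or everything (`exists_closedBall_touching`).
-/

/-! ### Directional derivatives of smooth functions -/

/-- The derivative of `f` in the direction `v`, as a function of the base point. -/
noncomputable def dirDeriv {E : Type*} [NormedAddCommGroup E] [NormedSpace ℝ E] (v : E) (f : E → ℝ)
    (x : E) : ℝ :=
  fderiv ℝ f x v

section DirDeriv

variable {E : Type*} [NormedAddCommGroup E] [NormedSpace ℝ E] {Ω : Set E} {f g : E → ℝ} {x : E}

theorem ContDiffOn.contDiffAt_of_isOpen (hf : ContDiffOn ℝ ∞ f Ω) (hΩ : IsOpen Ω) (hx : x ∈ Ω) :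
    ContDiffAt ℝ ∞ f x :=
  hf.contDiffAt (hΩ.mem_nhds hx)

theorem ContDiffOn.differentiableAt_of_isOpen (hf : ContDiffOn ℝ ∞ f Ω) (hΩ : IsOpen Ω)
    (hx : x ∈ Ω) : DifferentiableAt ℝ f x :=
  (hf.contDiffAt_of_isOpen hΩ hx).differentiableAt (by simp)

theorem contDiffOn_dirDeriv (hf : ContDiffOn ℝ ∞ f Ω) (hΩ : IsOpen Ω) (v : E) :
    ContDiffOn ℝ ∞ (dirDeriv v f) Ω :=
  (hf.fderiv_of_isOpen hΩ (m := ∞) (by simp)).clm_apply contDiffOn_const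

theorem dirDeriv_congr (hΩ : IsOpen Ω) (h : Set.EqOn f g Ω) (v : E) :
    Set.EqOn (dirDeriv v f) (dirDeriv v g) Ω := by
  intro x hx
  have : f =ᶠ[nhds x] g := Filter.eventuallyEq_of_mem (hΩ.mem_nhds hx) h
  simp only [dirDeriv, this.fderiv_eq]

theorem dirDeriv_dirDeriv_eq_fderiv_fderiv (hf : ContDiffOn ℝ ∞ f Ω) (hΩ : IsOpen Ω) (hx : x ∈ Ω)
    (v w : E) : dirDeriv v (dirDeriv w f) x = fderiv ℝ (fderiv ℝ f) x v w := by
  have h : DifferentiableAt ℝ (fderiv ℝ f) x :=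
    ((hf.fderiv_of_isOpen hΩ (m := ∞) (by simp)).contDiffAt (hΩ.mem_nhds hx)).differentiableAt
      (by simp)
  have h2 : dirDeriv w f = fun y => fderiv ℝ f y w := rfl
  rw [dirDeriv, h2, fderiv_clm_apply h (differentiableAt_const w)]
  simp

theorem dirDeriv_comm (hf : ContDiffOn ℝ ∞ f Ω) (hΩ : IsOpen Ω) (v w : E) :
    Set.EqOn (dirDeriv v (dirDeriv w f)) (dirDeriv w (dirDeriv v f)) Ω := by
  intro x hx
  rw [dirDeriv_dirDeriv_eq_fderiv_fderiv hf hΩ hx, dirDeriv_dirDeriv_eq_fderiv_fderiv hf hΩ hx]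
  exact ((hf.contDiffAt_of_isOpen hΩ hx).isSymmSndFDerivAt
    (by simpa using ENat.LEInfty.out)) v w

theorem dirDeriv_comm₃ (hf : ContDiffOn ℝ ∞ f Ω) (hΩ : IsOpen Ω) (v w z : E) :
    Set.EqOn (dirDeriv v (dirDeriv w (dirDeriv z f))) (dirDeriv v (dirDeriv z (dirDeriv w f))) Ω :=
  dirDeriv_congr hΩ (dirDeriv_comm hf hΩ w z) v

/-- Four directional derivatives may be exchanged in pairs. -/
theorem dirDeriv_comm₄ (hf : ContDiffOn ℝ ∞ f Ω) (hΩ : IsOpen Ω) (v w y z : E) :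
    Set.EqOn (dirDeriv v (dirDeriv w (dirDeriv y (dirDeriv z f))))
      (dirDeriv y (dirDeriv z (dirDeriv v (dirDeriv w f)))) Ω := by
  have hs := fun a => contDiffOn_dirDeriv hf hΩ a
  have hs2 := fun a b => contDiffOn_dirDeriv (hs a) hΩ b
  intro x hx
  rw [dirDeriv_comm₃ (hs z) hΩ v w y hx, dirDeriv_comm (hs2 z w) hΩ v y hx,
    dirDeriv_congr hΩ (dirDeriv_congr hΩ (dirDeriv_comm hf hΩ w z) v) y hx,
    dirDeriv_congr hΩ (dirDeriv_comm (hs w) hΩ v z) y hx]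

theorem dirDeriv_sum {ι : Type*} (s : Finset ι) {F : ι → E → ℝ}
    (hF : ∀ i ∈ s, ContDiffOn ℝ ∞ (F i) Ω) (hΩ : IsOpen Ω) (hx : x ∈ Ω) (v : E) :
    dirDeriv v (fun y => ∑ i ∈ s, F i y) x = ∑ i ∈ s, dirDeriv v (F i) x := by
  unfold dirDeriv
  rw [fderiv_fun_sum fun i hi => (hF i hi).differentiableAt_of_isOpen hΩ hx]
  simp

theorem dirDeriv_comp {G : ℝ → ℝ} {J : Set ℝ} (hG : ContDiffOn ℝ ∞ G J) (hJ : IsOpen J)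
    (hf : ContDiffOn ℝ ∞ f Ω) (hΩ : IsOpen Ω) (hfJ : ∀ x ∈ Ω, f x ∈ J) (v : E) :
    Set.EqOn (dirDeriv v fun y => G (f y)) (fun y => deriv G (f y) * dirDeriv v f y) Ω := by
  intro x hx
  have hGd : HasDerivAt G (deriv G (f x)) (f x) :=
    (hG.differentiableAt_of_isOpen hJ (hfJ x hx)).hasDerivAt
  have := hGd.comp_hasFDerivAt x (hf.differentiableAt_of_isOpen hΩ hx).hasFDerivAt
  simp only [dirDeriv]
  rw [show (fun y => G (f y)) = G ∘ f from rfl, this.fderiv]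
  simp

theorem dirDeriv_mul (hf : ContDiffOn ℝ ∞ f Ω) (hg : ContDiffOn ℝ ∞ g Ω) (hΩ : IsOpen Ω)
    (hx : x ∈ Ω) (v : E) :
    dirDeriv v (fun y => f y * g y) x = f x * dirDeriv v g x + g x * dirDeriv v f x := by
  simp only [dirDeriv]
  rw [fderiv_fun_mul (hf.differentiableAt_of_isOpen hΩ hx) (hg.differentiableAt_of_isOpen hΩ hx)]
  simp

/-- The second derivatives of a composition `G ∘ f` with a function of one real variable. -/
theorem dirDeriv_dirDeriv_comp {G : ℝ → ℝ} {J : Set ℝ} (hG : ContDiffOn ℝ ∞ G J) (hJ : IsOpen J)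
    (hf : ContDiffOn ℝ ∞ f Ω) (hΩ : IsOpen Ω) (hfJ : ∀ x ∈ Ω, f x ∈ J) (hx : x ∈ Ω) (v w : E) :
    dirDeriv v (dirDeriv w fun y => G (f y)) x =
      deriv G (f x) * dirDeriv v (dirDeriv w f) x +
        deriv (deriv G) (f x) * (dirDeriv v f x * dirDeriv w f x) := by
  have hG' : ContDiffOn ℝ ∞ (deriv G) J := hG.deriv_of_isOpen hJ (by simp)
  rw [dirDeriv_congr hΩ (dirDeriv_comp hG hJ hf hΩ hfJ w) v hx,
    dirDeriv_mul (f := fun y => deriv G (f y)) (hG'.comp hf hfJ) (contDiffOn_dirDeriv hf hΩ w) hΩ hx,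
    dirDeriv_comp hG' hJ hf hΩ hfJ v hx]
  ring

theorem hasDerivAt_dirDeriv (hf : ContDiffOn ℝ ∞ f Ω) (hΩ : IsOpen Ω) {v : E} {t : ℝ}
    (ht : x + t • v ∈ Ω) :
    HasDerivAt (fun s : ℝ => f (x + s • v)) (dirDeriv v f (x + t • v)) t := by
  have h1 : HasDerivAt (fun s : ℝ => x + s • v) v t := by
    simpa using ((hasDerivAt_id t).smul_const v).const_add x
  exact (hf.differentiableAt_of_isOpen hΩ ht).hasFDerivAt.comp_hasDerivAt t h1

theorem eventually_add_smul_mem (hΩ : IsOpen Ω) (hx : x ∈ Ω) (v : E) :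
    ∀ᶠ t : ℝ in nhds 0, x + t • v ∈ Ω := by
  have h : ContinuousAt (fun t : ℝ => x + t • v) 0 := by fun_prop
  exact h.eventually_mem (hΩ.mem_nhds (by simpa using hx))

end DirDeriv

/-! ### Second-order conditions at a minimum on the line -/

/-- The second derivative of a function of one variable at a local minimum is nonnegative. -/
theorem IsLocalMin.second_deriv_nonneg {g g' : ℝ → ℝ} {a c : ℝ} (h : IsLocalMin g a)
    (hg : ∀ᶠ t in nhds a, HasDerivAt g (g' t) t) (hg' : HasDerivAt g' c a) : 0 ≤ c := by
  by_contra! hc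
  have hd : deriv g =ᶠ[nhds a] g' := hg.mono fun t ht => ht.deriv
  have hdd : deriv (deriv g) a = c := by rw [hd.deriv_eq, hg'.deriv]
  -- `a` would be a local maximum too, so `g` would be locally constant.
  have hmax : IsLocalMax g a := isLocalMax_of_deriv_deriv_neg (by rwa [hdd]) h.deriv_eq_zero
    hg.self_of_nhds.continuousAt
  have hconst : g =ᶠ[nhds a] fun _ => g a := by
    filter_upwards [h, hmax] with t h1 h2 using le_antisymm h2 h1
  have h0 : deriv g =ᶠ[nhds a] fun _ => 0 := by
    filter_upwards [hconst.eventuallyEq_nhds] with t ht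
    rw [ht.deriv_eq, deriv_const]
  rw [h0.deriv_eq, deriv_const] at hdd
  exact hc.ne hdd.symm

theorem second_order_nonneg_of_quadratic {a a' b b' c c' : ℝ → ℝ} {a'' b'' c'' : ℝ}
    (ha : ∀ᶠ t in nhds 0, HasDerivAt a (a' t) t) (ha' : HasDerivAt a' a'' 0)
    (hb : ∀ᶠ t in nhds 0, HasDerivAt b (b' t) t) (hb' : HasDerivAt b' b'' 0)
    (hc : ∀ᶠ t in nhds 0, HasDerivAt c (c' t) t) (hc' : HasDerivAt c' c'' 0)
    (h0 : a 0 = 0) (h : ∀ᶠ t in nhds 0, 0 ≤ a t + t * b t + t ^ 2 * c t) :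
    0 ≤ a'' + 2 * b' 0 + 2 * c 0 := by
  have hmin : IsLocalMin (fun t => a t + t * b t + t ^ 2 * c t) 0 := by
    filter_upwards [h] with t ht
    simpa [h0] using ht
  refine hmin.second_deriv_nonneg
    (g' := fun t => a' t + (b t + t * b' t) + (2 * t * c t + t ^ 2 * c' t)) ?_ ?_
  · filter_upwards [ha, hb, hc] with t h1 h2 h3
    exact ((h1.add ((hasDerivAt_id t).mul h2)).add (((hasDerivAt_id t).pow 2).mul h3)).congr_deriv
      (by simp)
  · have h2 := hb.self_of_nhds
    have h3 := hc.self_of_nhds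
    exact ((ha'.add (h2.add ((hasDerivAt_id (0 : ℝ)).mul hb'))).add
      ((((hasDerivAt_id (0 : ℝ)).const_mul 2).mul h3).add
        (((hasDerivAt_id (0 : ℝ)).pow 2).mul hc'))).congr_deriv (by simp; ring)

/-! ### First and second derivatives of a determinant -/

section Det

variable {n : ℕ}

open Matrix

/-- Jacobi's formula for the derivative of the determinant of a matrix-valued function. -/
theorem hasDerivAt_det {M : ℝ → Matrix (Fin n) (Fin n) ℝ} {M' : Matrix (Fin n) (Fin n) ℝ} {t : ℝ}
    (h : ∀ i j, HasDerivAt (fun s => M s i j) (M' i j) t) :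
    HasDerivAt (fun s => (M s).det) (∑ i, ∑ r, (M t).adjugate i r * M' r i) t := by
  have h1 : HasDerivAt (fun s => (M s).det) (∑ σ : Equiv.Perm (Fin n),
      ((Equiv.Perm.sign σ : ℤ) : ℝ) *
        ∑ i, (∏ j ∈ Finset.univ.erase i, M t (σ j) j) • M' (σ i) i) t := by
    simp only [det_apply']
    refine HasDerivAt.fun_sum fun σ _ => HasDerivAt.const_mul _ ?_
    exact HasDerivAt.fun_finsetProd fun i _ => h (σ i) i
  refine h1.congr_deriv ?_
  have h2 : ∀ i, ∑ r, (M t).adjugate i r * M' r i =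
      ((M t).updateCol i fun r => M' r i).det := by
    intro i
    rw [← cramer_apply, cramer_eq_adjugate_mulVec]
    rfl
  simp only [h2, det_apply', Finset.mul_sum]
  rw [Finset.sum_comm]
  refine Finset.sum_congr rfl fun i _ => Finset.sum_congr rfl fun σ _ => ?_
  rw [← Finset.mul_prod_erase _ _ (Finset.mem_univ i)]
  rw [Finset.prod_congr rfl fun j hj => updateCol_ne (Finset.ne_of_mem_erase hj)]
  simp [mul_comm]

theorem exists_hasDerivAt_adjugate {M : ℝ → Matrix (Fin n) (Fin n) ℝ}
    {M' : Matrix (Fin n) (Fin n) ℝ} {t : ℝ}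
    (h : ∀ i j, HasDerivAt (fun s => M s i j) (M' i j) t) :
    ∃ N : Matrix (Fin n) (Fin n) ℝ,
      ∀ i j, HasDerivAt (fun s => (M s).adjugate i j) (N i j) t := by
  have key : ∀ i j, ∃ c, HasDerivAt (fun s => (M s).adjugate i j) c t := by
    intro i j
    simp only [adjugate_apply]
    refine ⟨_, hasDerivAt_det (M' := M'.updateRow j 0) fun k l => ?_⟩
    by_cases hk : k = j
    · subst hk
      simpa using hasDerivAt_const t _
    · simpa [updateRow_ne hk] using h k l
  choose N hN using key
  exact ⟨N, hN⟩

theorem adjugate_diagonal_of_ne_zero {l : Fin n → ℝ} (hl : ∀ i, l i ≠ 0) (i j : Fin n) :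
    (diagonal l).adjugate i j = if i = j then (diagonal l).det / l i else 0 := by
  have h := congrFun (congrFun (mul_adjugate (diagonal l)) i) j
  rw [diagonal_mul, Matrix.smul_apply, one_apply] at h
  have := hl i
  split_ifs with hij
  · rw [if_pos hij, smul_eq_mul, mul_one] at h
    rw [eq_div_iff this, mul_comm, h]
  · simpa [if_neg hij, hl i] using h

/-- First- and second-order conditions for a local minimum of `det M` along a curve `M` of matrices
through a positive diagonal matrix. In matrix notation with `A = M 0`, they read
`tr (A⁻¹ M') = 0` and `tr (A⁻¹ M'') ≥ tr (A⁻¹ M' A⁻¹ M')`. -/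
theorem det_second_order_condition {M M' : ℝ → Matrix (Fin n) (Fin n) ℝ}
    {M'' : Matrix (Fin n) (Fin n) ℝ} {l : Fin n → ℝ} (hl : ∀ i, 0 < l i) (hM0 : M 0 = diagonal l)
    (hM : ∀ᶠ t in nhds 0, ∀ i j, HasDerivAt (fun s => M s i j) (M' t i j) t)
    (hM' : ∀ i j, HasDerivAt (fun s => M' s i j) (M'' i j) 0)
    (hmin : IsLocalMin (fun s => (M s).det) 0) :
    ∑ i, M' 0 i i / l i = 0 ∧
      ∑ i, ∑ j, M' 0 i j * M' 0 j i / (l i * l j) ≤ ∑ i, M'' i i / l i := by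
  have hl0 : ∀ i, l i ≠ 0 := fun i => (hl i).ne'
  set d := (M 0).det with hd
  have hdpos : 0 < d := by
    rw [hd, hM0, det_diagonal]
    exact Finset.prod_pos fun i _ => hl i
  have hadj : ∀ i j, (M 0).adjugate i j = if i = j then d / l i else 0 := by
    intro i j
    rw [hd, hM0, adjugate_diagonal_of_ne_zero hl0]
  have hM00 := hM.self_of_nhds
  have hdet := hM.mono fun t ht => hasDerivAt_det ht
  obtain ⟨N, hN⟩ := exists_hasDerivAt_adjugate hM00
  have hdet0 := hdet.self_of_nhds
  have hcrit := hmin.hasDerivAt_eq_zero hdet0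
  have hfirst : d * ∑ i, M' 0 i i / l i = 0 := by
    refine Eq.trans ?_ hcrit
    rw [Finset.mul_sum]
    refine Finset.sum_congr rfl fun i _ => ?_
    simp [hadj]
    ring
  -- Differentiating `M * adj M = det M • 1` at a critical point of `det M` determines `(adj M)'`.
  have hNval : ∀ i j, N i j = - (d * M' 0 i j / (l i * l j)) := by
    intro i j
    have h1 : HasDerivAt (fun s => (M s * (M s).adjugate) i j)
        (∑ k, (M' 0 i k * (M 0).adjugate k j + M 0 i k * N k j)) 0 := by
      simp only [mul_apply]
      exact HasDerivAt.fun_sum fun k _ => (hM00 i k).mul (hN k j)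
    have h2 : HasDerivAt (fun s => (M s * (M s).adjugate) i j) 0 0 := by
      simp only [mul_adjugate, Matrix.smul_apply, smul_eq_mul]
      rw [hcrit] at hdet0
      simpa using hdet0.mul_const ((1 : Matrix (Fin n) (Fin n) ℝ) i j)
    have h3 := h1.unique h2
    simp only [Finset.sum_add_distrib, hadj] at h3
    simp only [hM0, diagonal_apply, mul_ite, mul_zero, ite_mul, zero_mul, Finset.sum_ite_eq,
      Finset.sum_ite_eq', Finset.mem_univ, if_true] at h3
    have := hl0 i
    have := hl0 j
    field_simp at h3 ⊢
    linarith
  have hsecond := hmin.second_deriv_nonneg hdet (c := ∑ i, ∑ r,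
    (N i r * M' 0 r i + (M 0).adjugate i r * M'' r i)) <|
      HasDerivAt.fun_sum fun i _ => HasDerivAt.fun_sum fun r _ => (hN i r).mul (hM' r i)
  refine ⟨(mul_eq_zero.1 hfirst).resolve_left hdpos.ne', ?_⟩
  have h4 : ∑ i, ∑ r, (N i r * M' 0 r i + (M 0).adjugate i r * M'' r i) =
      d * (∑ i, M'' i i / l i - ∑ i, ∑ j, M' 0 i j * M' 0 j i / (l i * l j)) := by
    rw [← Finset.sum_sub_distrib, Finset.mul_sum]
    refine Finset.sum_congr rfl fun i _ => ?_
    simp only [Finset.sum_add_distrib, hadj, hNval, ite_mul, zero_mul, Finset.sum_ite_eq,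
      Finset.mem_univ, if_true]
    rw [mul_sub, Finset.mul_sum, sub_eq_add_neg, ← Finset.sum_neg_distrib, add_comm]
    congr 1
    · ring
    · exact Finset.sum_congr rfl fun j _ => by ring
  rw [h4] at hsecond
  have := nonneg_of_mul_nonneg_right hsecond hdpos
  linarith

end Det

/-! ### An inequality for symmetric three-tensors -/

/-- Here `a i` stands for `u_{iik} / λ_i`. The left side collects the squares of those third
derivatives in which `k` occurs with a repeated index, multiplied by `λ_k`. -/
theorem sq_sum_le_of_sum_eq_zero {n : ℕ} (hn : 2 ≤ n) {l a : Fin n → ℝ} (hl : ∀ i, 0 < l i)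
    (ha : ∑ i, a i = 0) (k : Fin n) :
    (n : ℝ) / (n - 1) * ((∑ i, l i * a i) ^ 2 / ∑ i, l i) ≤
      ∑ i, l k * a i ^ 2 + ∑ i, if i = k then 0 else 2 * (l i * a i ^ 2) := by
  have hn1 : (0 : ℝ) < n - 1 := by
    have : (2 : ℝ) ≤ n := by exact_mod_cast hn
    linarith
  have hS : 0 < ∑ i, l i := Finset.sum_pos (fun i _ => hl i) ⟨k, Finset.mem_univ k⟩
  set Q := ∑ i, l i * a i ^ 2 with hQ
  -- Cauchy-Schwarz with the weights `l`.
  have hCS : (∑ i, l i * a i) ^ 2 / ∑ i, l i ≤ Q := by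
    rw [div_le_iff₀ hS]
    have := Finset.sum_sq_le_sum_mul_sum_of_sq_le_mul Finset.univ (r := fun i => l i * a i)
      (f := fun i => l i * a i ^ 2) (g := l) (fun i _ => by have := hl i; positivity)
      (fun i _ => (hl i).le) (fun i _ => le_of_eq (by ring))
    exact this
  have hQk : l k * a k ^ 2 ≤ Q :=
    Finset.single_le_sum (f := fun i => l i * a i ^ 2)
      (fun i _ => by have := hl i; positivity) (Finset.mem_univ k)
  -- Cauchy-Schwarz for the `n - 1` indices other than `k`.
  have hCS' : a k ^ 2 ≤ (n - 1) * ∑ i ∈ Finset.univ.erase k, a i ^ 2 := by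
    have h1 := sq_sum_le_card_mul_sum_sq (s := Finset.univ.erase k) (f := a)
    have h2 : ∑ i ∈ Finset.univ.erase k, a i = - a k := by
      have := Finset.add_sum_erase Finset.univ a (Finset.mem_univ k)
      linarith
    rw [h2, Finset.card_erase_of_mem (Finset.mem_univ k), Finset.card_univ, Fintype.card_fin,
      Nat.cast_sub (by omega), Nat.cast_one, neg_sq] at h1
    exact h1
  have hsum : ∑ i, a i ^ 2 = a k ^ 2 + ∑ i ∈ Finset.univ.erase k, a i ^ 2 :=
    (Finset.add_sum_erase Finset.univ (fun i => a i ^ 2) (Finset.mem_univ k)).symm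
  have hite : (∑ i, if i = k then 0 else 2 * (l i * a i ^ 2)) = 2 * Q - 2 * (l k * a k ^ 2) := by
    have : ∀ i, (if i = k then 0 else 2 * (l i * a i ^ 2)) =
        2 * (l i * a i ^ 2) - if i = k then 2 * (l i * a i ^ 2) else 0 := by
      intro i
      split_ifs <;> ring
    simp only [this, Finset.sum_sub_distrib, ← Finset.mul_sum]
    simp [hQ]
  rw [hite, ← Finset.mul_sum, hsum]
  set R := ∑ i ∈ Finset.univ.erase k, a i ^ 2
  have hR : a k ^ 2 / (n - 1) ≤ R := by
    rw [div_le_iff₀ hn1]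
    linarith
  have h1 : (n : ℝ) / (n - 1) * ((∑ i, l i * a i) ^ 2 / ∑ i, l i) ≤ (n : ℝ) / (n - 1) * Q := by
    gcongr
  have h2 : l k * (a k ^ 2 / (n - 1)) ≤ l k * R := mul_le_mul_of_nonneg_left hR (hl k).le
  -- With `c = (n - 2) / (n - 1)`, use `2 Q - c l_k a_k ^ 2 ≥ (2 - c) Q`.
  have h3 : 0 ≤ ((n : ℝ) - 2) / (n - 1) * (Q - l k * a k ^ 2) := by
    refine mul_nonneg (div_nonneg ?_ hn1.le) (by linarith)
    have : (2 : ℝ) ≤ n := by exact_mod_cast hn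
    linarith
  have h4 : (n : ℝ) / (n - 1) * Q + ((n : ℝ) - 2) / (n - 1) * (Q - l k * a k ^ 2) =
      2 * Q - l k * a k ^ 2 + l k * (a k ^ 2 / (n - 1)) := by
    field_simp
    ring
  linarith

/-- A lower bound for `∑ T i j k ^ 2 / (λ_i λ_j)`, where `T` is a symmetric tensor that is
trace-free in the metric `λ⁻¹` and whose Euclidean trace is the vector `g • w`. -/
theorem symmetric_tensor_inequality {n : ℕ} (hn : 2 ≤ n) {l w : Fin n → ℝ} {g : ℝ}
    {T : Fin n → Fin n → Fin n → ℝ} (hl : ∀ i, 0 < l i)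
    (hT₁ : ∀ i j k, T i j k = T j i k) (hT₂ : ∀ i j k, T i j k = T i k j)
    (hzero : ∀ k, ∑ i, T i i k / l i = 0) (htrace : ∀ k, ∑ i, T i i k = g * w k) :
    (n : ℝ) / (n - 1) * (g ^ 2 / ∑ i, l i) * ∑ k, w k ^ 2 / l k ≤
      ∑ k, ∑ i, ∑ j, T i j k ^ 2 / (l i * l j) := by
  have hpos : ∀ i j k, 0 ≤ T i j k ^ 2 / (l i * l j) := fun i j k => by
    have := hl i
    have := hl j
    positivity
  -- The index triples `(i, i, k)`, `(i, k, i)` and `(k, i, i)`, with `i ≠ k` in the last two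
  -- families, are pairwise distinct.
  have hsplit : ∀ k i j, (if i = j then T i j k ^ 2 / (l i * l j) else 0) +
      (if i = k then (if j = k then 0 else T i j k ^ 2 / (l i * l j)) else 0) +
      (if j = k then (if i = k then 0 else T i j k ^ 2 / (l i * l j)) else 0) ≤
        T i j k ^ 2 / (l i * l j) := by
    intro k i j
    have := hpos i j k
    split_ifs <;> simp_all
  have hA : ∀ k, ∑ i, ∑ j, (if i = j then T i j k ^ 2 / (l i * l j) else 0) =
      ∑ i, (T i i k / l i) ^ 2 := fun k => Finset.sum_congr rfl fun i _ => by
    simp only [Finset.sum_ite_eq, Finset.mem_univ, if_true, sq, div_mul_div_comm]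
  have hB : ∑ k, ∑ i, ∑ j, (if i = k then (if j = k then 0 else T i j k ^ 2 / (l i * l j)) else 0) =
      ∑ k, ∑ i, if i = k then 0 else T i i k ^ 2 / (l i * l k) := by
    conv_rhs => rw [Finset.sum_comm]
    refine Finset.sum_congr rfl fun k _ => ?_
    rw [Finset.sum_comm]
    refine Finset.sum_congr rfl fun j _ => ?_
    simp only [Finset.sum_ite_eq', Finset.mem_univ, if_true, eq_comm (a := k) (b := j), hT₂ k j k,
      mul_comm]
  have hC : ∑ k, ∑ i, ∑ j, (if j = k then (if i = k then 0 else T i j k ^ 2 / (l i * l j)) else 0) =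
      ∑ k, ∑ i, if i = k then 0 else T i i k ^ 2 / (l i * l k) := by
    conv_rhs => rw [Finset.sum_comm]
    refine Finset.sum_congr rfl fun k _ => Finset.sum_congr rfl fun i _ => ?_
    simp only [Finset.sum_ite_eq', Finset.mem_univ, if_true, eq_comm (a := k) (b := i), hT₁ i k k,
      hT₂ k i k, mul_comm]
  have hk : ∀ k, (n : ℝ) / (n - 1) * (g ^ 2 / ∑ i, l i) * (w k ^ 2 / l k) ≤
      ∑ i, (T i i k / l i) ^ 2 + 2 * ∑ i, if i = k then 0 else T i i k ^ 2 / (l i * l k) := by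
    intro k
    have h1 := sq_sum_le_of_sum_eq_zero hn hl (hzero k) k
    have h2 : ∑ i, l i * (T i i k / l i) = g * w k := by
      rw [← htrace k]
      exact Finset.sum_congr rfl fun i _ => mul_div_cancel₀ _ (hl i).ne'
    have h3 : ∑ i, l k * (T i i k / l i) ^ 2 +
        ∑ i, (if i = k then 0 else 2 * (l i * (T i i k / l i) ^ 2)) =
        l k * (∑ i, (T i i k / l i) ^ 2 +
          2 * ∑ i, if i = k then 0 else T i i k ^ 2 / (l i * l k)) := by
      rw [mul_add, Finset.mul_sum, Finset.mul_sum, Finset.mul_sum]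
      congr 1
      refine Finset.sum_congr rfl fun i _ => ?_
      have := hl i
      have := hl k
      split_ifs
      · simp
      · field_simp
    rw [h2, h3] at h1
    have := hl k
    refine le_of_mul_le_mul_left (le_of_eq_of_le ?_ h1) this
    field_simp
  calc _ = ∑ k, (n : ℝ) / (n - 1) * (g ^ 2 / ∑ i, l i) * (w k ^ 2 / l k) := Finset.mul_sum ..
    _ ≤ ∑ k, (∑ i, (T i i k / l i) ^ 2 +
          2 * ∑ i, if i = k then 0 else T i i k ^ 2 / (l i * l k)) :=
        Finset.sum_le_sum fun k _ => hk k
    _ = ∑ k, ∑ i, ∑ j, ((if i = j then T i j k ^ 2 / (l i * l j) else 0) +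
          (if i = k then (if j = k then 0 else T i j k ^ 2 / (l i * l j)) else 0) +
          (if j = k then (if i = k then 0 else T i j k ^ 2 / (l i * l j)) else 0)) := by
        simp only [Finset.sum_add_distrib]
        rw [hB, hC]
        simp only [hA, ← Finset.mul_sum]
        ring
    _ ≤ _ := Finset.sum_le_sum fun k _ => Finset.sum_le_sum fun i _ => Finset.sum_le_sum fun j _ =>
        hsplit k i j

/-! ### The Hessian matrix and the Laplacian -/

section Hessian

variable {n : ℕ} {Ω : Set (EuclideanSpace ℝ (Fin n))} {u : EuclideanSpace ℝ (Fin n) → ℝ}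
  {x : EuclideanSpace ℝ (Fin n)}

open Matrix

theorem iteratedFDeriv_two_eq_dirDeriv (hu : ContDiffOn ℝ ∞ u Ω) (hΩ : IsOpen Ω) (hx : x ∈ Ω)
    (v w : EuclideanSpace ℝ (Fin n)) :
    iteratedFDeriv ℝ 2 u x ![v, w] = dirDeriv v (dirDeriv w u) x := by
  rw [dirDeriv_dirDeriv_eq_fderiv_fderiv hu hΩ hx, iteratedFDeriv_two_apply]
  simp

theorem laplacian_eq_sum_dirDeriv (hu : ContDiffOn ℝ ∞ u Ω) (hΩ : IsOpen Ω) (hx : x ∈ Ω)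
    (b : OrthonormalBasis (Fin n) ℝ (EuclideanSpace ℝ (Fin n))) :
    Laplacian.laplacian u x = ∑ i, dirDeriv (b i) (dirDeriv (b i) u) x := by
  rw [InnerProductSpace.laplacian_eq_iteratedFDeriv_orthonormalBasis u b]
  exact Finset.sum_congr rfl fun i _ => iteratedFDeriv_two_eq_dirDeriv hu hΩ hx _ _

theorem dirDeriv_dirDeriv_eq_dotProduct (hu : ContDiffOn ℝ ∞ u Ω) (hΩ : IsOpen Ω) (hx : x ∈ Ω)
    (v w : EuclideanSpace ℝ (Fin n)) :
    dirDeriv v (dirDeriv w u) x = v.ofLp ⬝ᵥ hessianMatrix u x *ᵥ w.ofLp := by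
  have hexp : ∀ y : EuclideanSpace ℝ (Fin n), y = ∑ i, y i • EuclideanSpace.single i (1 : ℝ) := by
    intro y
    simpa using ((EuclideanSpace.basisFun (Fin n) ℝ).sum_repr y).symm
  rw [dirDeriv_dirDeriv_eq_fderiv_fderiv hu hΩ hx]
  conv_lhs => rw [hexp v, hexp w]
  simp only [map_sum, map_smul, _root_.sum_apply, _root_.smul_apply,
    dotProduct, mulVec, hessianMatrix, of_apply, iteratedFDeriv_two_eq_dirDeriv hu hΩ hx,
    dirDeriv_dirDeriv_eq_fderiv_fderiv hu hΩ hx, smul_eq_mul]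
  simp only [Finset.mul_sum]
  rw [Finset.sum_comm]
  exact Finset.sum_congr rfl fun i _ => Finset.sum_congr rfl fun j _ => by ring

theorem hessianMatrix_isHermitian (hu : ContDiffOn ℝ ∞ u Ω) (hΩ : IsOpen Ω) (hx : x ∈ Ω) :
    (hessianMatrix u x).IsHermitian := by
  ext i j
  simp only [conjTranspose_apply, hessianMatrix, of_apply, star_trivial,
    iteratedFDeriv_two_eq_dirDeriv hu hΩ hx]
  exact dirDeriv_comm hu hΩ _ _ hx

theorem IsConvexFunctionOn.dirDeriv_dirDeriv_nonneg (hc : IsConvexFunctionOn Ω u)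
    (hu : ContDiffOn ℝ ∞ u Ω) (hΩ : IsOpen Ω) (hx : x ∈ Ω) (v : EuclideanSpace ℝ (Fin n)) :
    0 ≤ dirDeriv v (dirDeriv v u) x := by
  obtain ⟨r, hr, hball⟩ := Metric.isOpen_iff.1 hΩ x hx
  have hconv := hc _ hball (convex_ball x r)
  -- The symmetric second difference of `u` is minimal at zero step length.
  have hmin : IsLocalMin (fun t : ℝ => u (x + t • v) + u (x + t • -v)) 0 := by
    filter_upwards [eventually_add_smul_mem Metric.isOpen_ball (Metric.mem_ball_self hr) v,
      eventually_add_smul_mem Metric.isOpen_ball (Metric.mem_ball_self hr) (-v)] with t h1 h2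
    have h3 := hconv.2 h1 h2 (show (0 : ℝ) ≤ 1 / 2 by norm_num) (show (0 : ℝ) ≤ 1 / 2 by norm_num)
      (by norm_num)
    have h4 : (1 / 2 : ℝ) • (x + t • v) + (1 / 2 : ℝ) • (x + t • -v) = x := by module
    rw [h4] at h3
    simp only [smul_eq_mul, zero_smul, add_zero] at h3 ⊢
    linarith
  have hd : ∀ w : EuclideanSpace ℝ (Fin n), ∀ᶠ t : ℝ in nhds 0,
      HasDerivAt (fun s : ℝ => u (x + s • w)) (dirDeriv w u (x + t • w)) t := fun w =>
    (eventually_add_smul_mem hΩ hx w).mono fun t ht => hasDerivAt_dirDeriv hu hΩ ht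
  have hdd : ∀ w : EuclideanSpace ℝ (Fin n), HasDerivAt (fun s : ℝ => dirDeriv w u (x + s • w))
      (dirDeriv w (dirDeriv w u) (x + (0 : ℝ) • w)) 0 := fun w =>
    hasDerivAt_dirDeriv (contDiffOn_dirDeriv hu hΩ w) hΩ (by simpa using hx)
  have h := hmin.second_deriv_nonneg
    (by filter_upwards [hd v, hd (-v)] with t h1 h2 using h1.add h2) ((hdd v).add (hdd (-v)))
  simp only [zero_smul, add_zero, dirDeriv_dirDeriv_eq_fderiv_fderiv hu hΩ hx, map_neg,
    _root_.neg_apply, neg_neg] at h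
  rw [dirDeriv_dirDeriv_eq_fderiv_fderiv hu hΩ hx]
  linarith

theorem IsConvexFunctionOn.posSemidef_hessianMatrix (hc : IsConvexFunctionOn Ω u)
    (hu : ContDiffOn ℝ ∞ u Ω) (hΩ : IsOpen Ω) (hx : x ∈ Ω) : (hessianMatrix u x).PosSemidef := by
  refine PosSemidef.of_dotProduct_mulVec_nonneg (hessianMatrix_isHermitian hu hΩ hx) fun v => ?_
  simpa [dirDeriv_dirDeriv_eq_dotProduct hu hΩ hx] using
    hc.dirDeriv_dirDeriv_nonneg hu hΩ hx (WithLp.toLp 2 v)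

/-- For a convex function, the Hessian determinant vanishes exactly where some unit vector is a
null direction of the Hessian quadratic form. -/
theorem IsConvexFunctionOn.det_hessianMatrix_eq_zero_iff (hc : IsConvexFunctionOn Ω u)
    (hu : ContDiffOn ℝ ∞ u Ω) (hΩ : IsOpen Ω) (hx : x ∈ Ω) :
    (hessianMatrix u x).det = 0 ↔
      ∃ e : EuclideanSpace ℝ (Fin n), ‖e‖ = 1 ∧ dirDeriv e (dirDeriv e u) x = 0 := by
  rw [← exists_mulVec_eq_zero_iff]
  constructor
  · rintro ⟨v, hv, hv0⟩
    have hv' : WithLp.toLp 2 v ≠ 0 := by simpa using hv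
    refine ⟨‖WithLp.toLp 2 v‖⁻¹ • WithLp.toLp 2 v, by
      rw [norm_smul, norm_inv, norm_norm, inv_mul_cancel₀ (norm_ne_zero_iff.2 hv')], ?_⟩
    rw [dirDeriv_dirDeriv_eq_dotProduct hu hΩ hx]
    simp [mulVec_smul, hv0]
  · rintro ⟨e, he, h0⟩
    refine ⟨e.ofLp, fun h => ?_, ?_⟩
    · have : e = 0 := by ext i; simpa using congrFun h i
      simp [this] at he
    · rw [dirDeriv_dirDeriv_eq_dotProduct hu hΩ hx] at h0
      exact ((hc.posSemidef_hessianMatrix hu hΩ hx).dotProduct_mulVec_zero_iff _).1 (by simpa using h0)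

/-- The determinant of the Hessian may be computed in any orthonormal basis. -/
theorem det_hessianMatrix_eq_orthonormalBasis (hu : ContDiffOn ℝ ∞ u Ω) (hΩ : IsOpen Ω)
    (hx : x ∈ Ω) (b : OrthonormalBasis (Fin n) ℝ (EuclideanSpace ℝ (Fin n))) :
    (Matrix.of fun i j => dirDeriv (b i) (dirDeriv (b j) u) x).det = (hessianMatrix u x).det := by
  set P : Matrix (Fin n) (Fin n) ℝ := Matrix.of fun i j => b i j with hP
  have h1 : (Matrix.of fun i j => dirDeriv (b i) (dirDeriv (b j) u) x) =
      P * hessianMatrix u x * Pᵀ := by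
    ext i j
    rw [of_apply, dirDeriv_dirDeriv_eq_dotProduct hu hΩ hx, Matrix.mul_assoc]
    simp [mul_apply, dotProduct, mulVec, hP]
  have h2 : P * Pᵀ = 1 := by
    ext i j
    have h := orthonormal_iff_ite.1 b.orthonormal i j
    simp only [PiLp.inner_apply, RCLike.inner_apply, conj_trivial] at h
    simp only [mul_apply, hP, transpose_apply, of_apply, one_apply]
    rw [← h]
    exact Finset.sum_congr rfl fun k _ => mul_comm _ _
  have h3 : P.det * P.det = 1 := by simpa using congrArg det h2
  rw [h1, det_mul, det_mul, det_transpose]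
  linear_combination (hessianMatrix u x).det * h3

/-- The Hessian is diagonal at a given point in a suitable orthonormal basis. -/
theorem exists_orthonormalBasis_dirDeriv_dirDeriv_eq_ite (hu : ContDiffOn ℝ ∞ u Ω) (hΩ : IsOpen Ω)
    (hx : x ∈ Ω) : ∃ (b : OrthonormalBasis (Fin n) ℝ (EuclideanSpace ℝ (Fin n))) (l : Fin n → ℝ),
      ∀ i j, dirDeriv (b i) (dirDeriv (b j) u) x = if i = j then l i else 0 := by
  have hH := hessianMatrix_isHermitian hu hΩ hx
  refine ⟨hH.eigenvectorBasis, hH.eigenvalues, fun i j => ?_⟩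
  rw [dirDeriv_dirDeriv_eq_dotProduct hu hΩ hx, hH.mulVec_eigenvectorBasis, dotProduct_smul]
  have h := orthonormal_iff_ite.1 hH.eigenvectorBasis.orthonormal j i
  rw [EuclideanSpace.inner_eq_star_dotProduct, star_trivial] at h
  rw [h]
  by_cases hij : i = j
  · simp [hij]
  · simp [hij, Ne.symm hij]

end Hessian

/-! ### The differentiated equation -/

section Equation

variable {n : ℕ} {Ω : Set (EuclideanSpace ℝ (Fin n))} {u : EuclideanSpace ℝ (Fin n) → ℝ}
  {x : EuclideanSpace ℝ (Fin n)} {J : Set ℝ} {G : ℝ → ℝ}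

theorem sum_dirDeriv_eqOn (hu : ContDiffOn ℝ ∞ u Ω) (hΩ : IsOpen Ω)
    (heq : ∀ x ∈ Ω, Laplacian.laplacian u x = G (u x))
    (b : OrthonormalBasis (Fin n) ℝ (EuclideanSpace ℝ (Fin n))) :
    Set.EqOn (fun y => ∑ k, dirDeriv (b k) (dirDeriv (b k) u) y) (fun y => G (u y)) Ω :=
  fun y hy => by simp only [← heq y hy, laplacian_eq_sum_dirDeriv hu hΩ hy b]

/-- The gradient of `Δu = G(u)`. -/
theorem sum_dirDeriv₃_eq (hG : ContDiffOn ℝ ∞ G J) (hJ : IsOpen J) (hu : ContDiffOn ℝ ∞ u Ω)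
    (hΩ : IsOpen Ω) (huJ : ∀ x ∈ Ω, u x ∈ J)
    (heq : ∀ x ∈ Ω, Laplacian.laplacian u x = G (u x)) (hx : x ∈ Ω)
    (b : OrthonormalBasis (Fin n) ℝ (EuclideanSpace ℝ (Fin n))) (v : EuclideanSpace ℝ (Fin n)) :
    ∑ k, dirDeriv v (dirDeriv (b k) (dirDeriv (b k) u)) x = deriv G (u x) * dirDeriv v u x := by
  have hs := fun k => contDiffOn_dirDeriv (contDiffOn_dirDeriv hu hΩ (b k)) hΩ (b k)
  rw [← dirDeriv_sum Finset.univ (fun k _ => hs k) hΩ hx v,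
    dirDeriv_congr hΩ (sum_dirDeriv_eqOn hu hΩ heq b) v hx, dirDeriv_comp hG hJ hu hΩ huJ v hx]

/-- The Hessian of `Δu = G(u)`. -/
theorem sum_dirDeriv₄_eq (hG : ContDiffOn ℝ ∞ G J) (hJ : IsOpen J) (hu : ContDiffOn ℝ ∞ u Ω)
    (hΩ : IsOpen Ω) (huJ : ∀ x ∈ Ω, u x ∈ J)
    (heq : ∀ x ∈ Ω, Laplacian.laplacian u x = G (u x)) (hx : x ∈ Ω)
    (b : OrthonormalBasis (Fin n) ℝ (EuclideanSpace ℝ (Fin n))) (v w : EuclideanSpace ℝ (Fin n)) :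
    ∑ k, dirDeriv (b k) (dirDeriv (b k) (dirDeriv v (dirDeriv w u))) x =
      deriv G (u x) * dirDeriv v (dirDeriv w u) x +
        deriv (deriv G) (u x) * (dirDeriv v u x * dirDeriv w u x) := by
  have hs := fun k => contDiffOn_dirDeriv (contDiffOn_dirDeriv hu hΩ (b k)) hΩ (b k)
  simp only [dirDeriv_comm₄ hu hΩ (b _) (b _) v w hx]
  rw [← dirDeriv_sum Finset.univ (fun k _ => contDiffOn_dirDeriv (hs k) hΩ w) hΩ hx v,
    ← dirDeriv_dirDeriv_comp hG hJ hu hΩ huJ hx v w]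
  refine dirDeriv_congr hΩ (fun y hy => ?_) v hx
  rw [← dirDeriv_congr hΩ (sum_dirDeriv_eqOn hu hΩ heq b) w hy,
    dirDeriv_sum Finset.univ (fun k _ => hs k) hΩ hy w]

end Equation

/-! ### Positive local minima of the Hessian determinant -/

/-- At a local minimum the Hessian determinant vanishes. Otherwise, in a basis diagonalizing
`D²u(p)`, the second-order condition for `log det D²u` summed over all directions would give
`0 ≤ n G'(u(p))`, because the third-order terms dominate the `G''` terms. -/
theorem det_hessianMatrix_eq_zero_of_isLocalMin {n : ℕ} (hn : 2 ≤ n)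
    {Ω : Set (EuclideanSpace ℝ (Fin n))} (hΩ : IsOpen Ω) {J : Set ℝ} (hJ : IsOpen J) {G : ℝ → ℝ}
    (hG : ContDiffOn ℝ ∞ G J) {u : EuclideanSpace ℝ (Fin n) → ℝ} (hu : ContDiffOn ℝ ∞ u Ω)
    (huJ : ∀ x ∈ Ω, u x ∈ J) (hc : IsConvexFunctionOn Ω u)
    (heq : ∀ x ∈ Ω, Laplacian.laplacian u x = G (u x)) {p : EuclideanSpace ℝ (Fin n)} (hp : p ∈ Ω)
    (hG₀ : 0 < G (u p)) (hG₁ : deriv G (u p) < 0)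
    (hG₂ : G (u p) * deriv (deriv G) (u p) ≤ (n : ℝ) / (n - 1) * deriv G (u p) ^ 2)
    (hmin : IsLocalMin (fun x => (hessianMatrix u x).det) p) : (hessianMatrix u p).det = 0 := by
  by_contra hdet
  obtain ⟨b, l, hb⟩ := exists_orthonormalBasis_dirDeriv_dirDeriv_eq_ite hu hΩ hp
  have hl : ∀ i, 0 < l i := by
    intro i
    have h1 : dirDeriv (b i) (dirDeriv (b i) u) p = l i := by simp [hb]
    refine lt_of_le_of_ne (h1 ▸ hc.dirDeriv_dirDeriv_nonneg hu hΩ hp (b i)) fun h0 => hdet ?_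
    exact (hc.det_hessianMatrix_eq_zero_iff hu hΩ hp).2 ⟨b i, b.norm_eq_one i, by rw [h1, h0]⟩
  have hs2 := fun i j => contDiffOn_dirDeriv (contDiffOn_dirDeriv hu hΩ (b j)) hΩ (b i)
  have hs3 := fun k i j => contDiffOn_dirDeriv (hs2 i j) hΩ (b k)
  -- The second-order condition along the line through `p` in the direction `b k`.
  have hline : ∀ k, ∑ i, dirDeriv (b k) (dirDeriv (b i) (dirDeriv (b i) u)) p / l i = 0 ∧
      ∑ i, ∑ j, dirDeriv (b k) (dirDeriv (b i) (dirDeriv (b j) u)) p *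
          dirDeriv (b k) (dirDeriv (b j) (dirDeriv (b i) u)) p / (l i * l j) ≤
        ∑ i, dirDeriv (b k) (dirDeriv (b k) (dirDeriv (b i) (dirDeriv (b i) u))) p / l i := by
    intro k
    have hp0 : p + (0 : ℝ) • b k = p := by simp
    have hmem := eventually_add_smul_mem hΩ hp (b k)
    have := det_second_order_condition
      (M := fun t => Matrix.of fun i j => dirDeriv (b i) (dirDeriv (b j) u) (p + t • b k))
      (M' := fun t => Matrix.of fun i j =>
        dirDeriv (b k) (dirDeriv (b i) (dirDeriv (b j) u)) (p + t • b k))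
      (M'' := Matrix.of fun i j =>
        dirDeriv (b k) (dirDeriv (b k) (dirDeriv (b i) (dirDeriv (b j) u))) p) hl
      (by
        ext i j
        simp [hb, Matrix.diagonal_apply])
      (by
        filter_upwards [hmem] with t ht i j
        exact hasDerivAt_dirDeriv (hs2 i j) hΩ ht)
      (by
        intro i j
        have := hasDerivAt_dirDeriv (hs3 k i j) hΩ (x := p) (v := b k) (t := 0) (by rwa [hp0])
        simpa only [hp0, Matrix.of_apply] using this)
      (by
        have hcont : Filter.Tendsto (fun t : ℝ => p + t • b k) (nhds 0) (nhds p) := by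
          have : ContinuousAt (fun t : ℝ => p + t • b k) 0 := by fun_prop
          simpa [ContinuousAt] using this
        filter_upwards [hmem, hcont.eventually hmin] with t ht hle
        rw [det_hessianMatrix_eq_orthonormalBasis hu hΩ ht, hp0,
          det_hessianMatrix_eq_orthonormalBasis hu hΩ hp]
        exact hle)
    simpa only [hp0, Matrix.of_apply] using this
  have hsumk := Finset.sum_le_sum fun k (_ : k ∈ Finset.univ) => (hline k).2
  have hrhs : ∑ k, ∑ i, dirDeriv (b k) (dirDeriv (b k) (dirDeriv (b i) (dirDeriv (b i) u))) p / l i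
      = n * deriv G (u p) + deriv (deriv G) (u p) * ∑ i, dirDeriv (b i) u p ^ 2 / l i := by
    rw [Finset.sum_comm, Finset.mul_sum]
    have : (n : ℝ) * deriv G (u p) = ∑ _i : Fin n, deriv G (u p) := by simp
    rw [this, ← Finset.sum_add_distrib]
    refine Finset.sum_congr rfl fun i _ => ?_
    rw [← Finset.sum_div, sum_dirDeriv₄_eq hG hJ hu hΩ huJ heq hp b, hb, if_pos rfl]
    have := (hl i).ne'
    field_simp
  have hsum : ∑ i, l i = G (u p) := by
    rw [← heq p hp, laplacian_eq_sum_dirDeriv hu hΩ hp b]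
    exact Finset.sum_congr rfl fun i _ => by simp [hb]
  have halg := symmetric_tensor_inequality hn (l := l) (w := fun k => dirDeriv (b k) u p)
    (g := deriv G (u p)) (T := fun i j k => dirDeriv (b k) (dirDeriv (b i) (dirDeriv (b j) u)) p)
    hl (fun i j k => dirDeriv_comm₃ hu hΩ _ _ _ hp)
    (fun i j k => by
      rw [dirDeriv_comm (contDiffOn_dirDeriv hu hΩ (b j)) hΩ (b k) (b i) hp,
        dirDeriv_comm₃ hu hΩ _ _ _ hp,
        dirDeriv_comm (contDiffOn_dirDeriv hu hΩ (b k)) hΩ (b i) (b j) hp])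
    (fun k => (hline k).1) (fun k => sum_dirDeriv₃_eq hG hJ hu hΩ huJ heq hp b (b k))
  have hlhs : ∀ k i j, dirDeriv (b k) (dirDeriv (b i) (dirDeriv (b j) u)) p *
      dirDeriv (b k) (dirDeriv (b j) (dirDeriv (b i) u)) p =
        dirDeriv (b k) (dirDeriv (b i) (dirDeriv (b j) u)) p ^ 2 := fun k i j => by
    rw [dirDeriv_comm₃ hu hΩ (b k) (b j) (b i) hp, sq]
  simp only [hlhs] at hsumk
  rw [hrhs] at hsumk
  rw [hsum] at halg
  set W := ∑ i, dirDeriv (b i) u p ^ 2 / l i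
  have hW : 0 ≤ W := Finset.sum_nonneg fun i _ => div_nonneg (sq_nonneg _) (hl i).le
  have h1 : deriv (deriv G) (u p) ≤ (n : ℝ) / (n - 1) * (deriv G (u p) ^ 2 / G (u p)) := by
    rw [← mul_div_assoc, le_div_iff₀ hG₀]
    linarith
  have h2 := mul_le_mul_of_nonneg_right h1 hW
  have h3 : (n : ℝ) * deriv G (u p) < 0 :=
    mul_neg_of_pos_of_neg (by exact_mod_cast (by omega : 0 < n)) hG₁
  linarith

/-! ### Quadratic forms touched from below -/

open scoped RealInnerProductSpace in
theorem sum_dirDeriv_mul_inner {n : ℕ} (b : OrthonormalBasis (Fin n) ℝ (EuclideanSpace ℝ (Fin n)))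
    (f : EuclideanSpace ℝ (Fin n) → ℝ) (e x : EuclideanSpace ℝ (Fin n)) :
    ∑ k, dirDeriv (b k) f x * ⟪e, b k⟫ = dirDeriv e f x := by
  unfold dirDeriv
  conv_rhs => rw [← b.sum_repr' e]
  rw [map_sum]
  refine Finset.sum_congr rfl fun k _ => ?_
  rw [map_smul, smul_eq_mul, mul_comm, real_inner_comm]

open scoped RealInnerProductSpace in
/-- If the least eigenvalue of `D²u` is touched from below at `x` by a smooth function `φ`, then
comparing `D²u(y)` with `φ(y)` on the vectors `e + s (y - x)`, where `e` is a least eigenvector at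
`x`, and taking the Laplacian at `y = x` gives this inequality for every real `s`. -/
theorem laplacian_le_of_touching_below {n : ℕ} {Ω : Set (EuclideanSpace ℝ (Fin n))}
    (hΩ : IsOpen Ω) {u φ : EuclideanSpace ℝ (Fin n) → ℝ} (hu : ContDiffOn ℝ ∞ u Ω)
    (hφ : ContDiffOn ℝ ∞ φ Ω) {x e : EuclideanSpace ℝ (Fin n)} (hx : x ∈ Ω) (he : ‖e‖ = 1)
    (htouch : dirDeriv e (dirDeriv e u) x = φ x)
    (hle : ∀ᶠ y in nhds x, ∀ v, φ y * ‖v‖ ^ 2 ≤ dirDeriv v (dirDeriv v u) y)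
    (b : OrthonormalBasis (Fin n) ℝ (EuclideanSpace ℝ (Fin n))) (s : ℝ) :
    ∑ k, dirDeriv (b k) (dirDeriv (b k) φ) x + 4 * s * dirDeriv e φ x + 2 * n * s ^ 2 * φ x ≤
      ∑ k, dirDeriv (b k) (dirDeriv (b k) (dirDeriv e (dirDeriv e u))) x +
        4 * s * ∑ k, dirDeriv e (dirDeriv (b k) (dirDeriv (b k) u)) x +
        2 * s ^ 2 * ∑ k, dirDeriv (b k) (dirDeriv (b k) u) x := by
  have hs2 := fun v w => contDiffOn_dirDeriv (contDiffOn_dirDeriv hu hΩ w) hΩ v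
  have hk : ∀ k, 0 ≤ (dirDeriv (b k) (dirDeriv (b k) (dirDeriv e (dirDeriv e u))) x -
      dirDeriv (b k) (dirDeriv (b k) φ) x) +
      2 * (2 * s * (dirDeriv e (dirDeriv (b k) (dirDeriv (b k) u)) x -
        dirDeriv (b k) φ x * ⟪e, b k⟫)) +
      2 * (s ^ 2 * (dirDeriv (b k) (dirDeriv (b k) u) x - φ x)) := by
    intro k
    have hx0 : x + (0 : ℝ) • b k = x := by simp
    have hmem := eventually_add_smul_mem hΩ hx (b k)
    have hd : ∀ {f : EuclideanSpace ℝ (Fin n) → ℝ}, ContDiffOn ℝ ∞ f Ω → ∀ᶠ t : ℝ in nhds 0,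
        HasDerivAt (fun t : ℝ => f (x + t • b k)) (dirDeriv (b k) f (x + t • b k)) t := fun hf =>
      hmem.mono fun t ht => hasDerivAt_dirDeriv hf hΩ ht
    have hd' : ∀ {f : EuclideanSpace ℝ (Fin n) → ℝ}, ContDiffOn ℝ ∞ f Ω →
        HasDerivAt (fun t : ℝ => dirDeriv (b k) f (x + t • b k))
          (dirDeriv (b k) (dirDeriv (b k) f) (x + (0 : ℝ) • b k)) 0 := fun hf =>
      (hd (contDiffOn_dirDeriv hf hΩ (b k))).self_of_nhds
    have hcont : Filter.Tendsto (fun t : ℝ => x + t • b k) (nhds 0) (nhds x) := by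
      have : ContinuousAt (fun t : ℝ => x + t • b k) 0 := by fun_prop
      simpa [ContinuousAt] using this
    have key := second_order_nonneg_of_quadratic
      (a := fun t => dirDeriv e (dirDeriv e u) (x + t • b k) - φ (x + t • b k))
      (b := fun t => 2 * s * (dirDeriv (b k) (dirDeriv e u) (x + t • b k) -
        φ (x + t • b k) * ⟪e, b k⟫))
      (c := fun t => s ^ 2 * (dirDeriv (b k) (dirDeriv (b k) u) (x + t • b k) - φ (x + t • b k)))
      (by filter_upwards [hd (hs2 e e), hd hφ] with t h1 h2 using h1.sub h2)
      ((hd' (hs2 e e)).sub (hd' hφ))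
      (by filter_upwards [hd (hs2 (b k) e), hd hφ] with t h1 h2 using
        (h1.sub (h2.mul_const ⟪e, b k⟫)).const_mul (2 * s))
      (((hd' (hs2 (b k) e)).sub ((hd' hφ).mul_const ⟪e, b k⟫)).const_mul (2 * s))
      (by filter_upwards [hd (hs2 (b k) (b k)), hd hφ] with t h1 h2 using
        (h1.sub h2).const_mul (s ^ 2))
      (((hd' (hs2 (b k) (b k))).sub (hd' hφ)).const_mul (s ^ 2))
      (by simp [htouch])
      (by
        filter_upwards [hmem, hcont.eventually hle] with t ht h
        have h1 := h (e + (s * t) • b k)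
        have h2 : ‖e + (s * t) • b k‖ ^ 2 = 1 + 2 * (s * t) * ⟪e, b k⟫ + (s * t) ^ 2 := by
          rw [norm_add_sq_real, he, norm_smul, b.norm_eq_one, inner_smul_right, mul_one,
            Real.norm_eq_abs, sq_abs]
          ring
        have h3 := dirDeriv_comm hu hΩ (b k) e ht
        rw [h2] at h1
        simp only [dirDeriv_dirDeriv_eq_fderiv_fderiv hu hΩ ht, map_add, map_smul,
          _root_.add_apply, _root_.smul_apply, smul_eq_mul] at h1 h3 ⊢
        rw [← h3] at h1
        linarith)
    simp only [hx0, Pi.sub_apply] at key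
    rw [dirDeriv_comm₃ hu hΩ (b k) (b k) e hx,
      dirDeriv_comm (contDiffOn_dirDeriv hu hΩ (b k)) hΩ (b k) e hx] at key
    exact key
  have hsum := Finset.sum_nonneg fun k (_ : k ∈ Finset.univ) => hk k
  simp only [Finset.sum_add_distrib, Finset.sum_sub_distrib, ← Finset.mul_sum,
    sum_dirDeriv_mul_inner, Finset.sum_const, Finset.card_univ, Fintype.card_fin,
    nsmul_eq_mul] at hsum
  linarith

/-- The least eigenvalue of `D²u` satisfies `Δλ ≤ 4 (G' u_e / G) λ_e` in the sense of test functions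
touching it from below at nonnegative values, with `e` a least eigenvector. -/
theorem laplacian_testFunction_le {n : ℕ} (hn : 2 ≤ n)
    {Ω : Set (EuclideanSpace ℝ (Fin n))} (hΩ : IsOpen Ω) {J : Set ℝ} (hJ : IsOpen J) {G : ℝ → ℝ}
    (hG : ContDiffOn ℝ ∞ G J) {u φ : EuclideanSpace ℝ (Fin n) → ℝ} (hu : ContDiffOn ℝ ∞ u Ω)
    (huJ : ∀ x ∈ Ω, u x ∈ J) (heq : ∀ x ∈ Ω, Laplacian.laplacian u x = G (u x))
    (hφ : ContDiffOn ℝ ∞ φ Ω) {x e : EuclideanSpace ℝ (Fin n)} (hx : x ∈ Ω)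
    (hG₀ : 0 < G (u x)) (hG₁ : deriv G (u x) < 0)
    (hG₂ : G (u x) * deriv (deriv G) (u x) ≤ (n : ℝ) / (n - 1) * deriv G (u x) ^ 2)
    (he : ‖e‖ = 1) (htouch : dirDeriv e (dirDeriv e u) x = φ x) (hφ₀ : 0 ≤ φ x)
    (hle : ∀ᶠ y in nhds x, ∀ v, φ y * ‖v‖ ^ 2 ≤ dirDeriv v (dirDeriv v u) y)
    (b : OrthonormalBasis (Fin n) ℝ (EuclideanSpace ℝ (Fin n))) :
    ∑ k, dirDeriv (b k) (dirDeriv (b k) φ) x ≤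
      4 * (deriv G (u x) * dirDeriv e u x / G (u x)) * dirDeriv e φ x := by
  set s := deriv G (u x) * dirDeriv e u x / G (u x) with hs
  -- The slope `-s` minimizes the right side of the touching inequality.
  have h := laplacian_le_of_touching_below hΩ hu hφ hx he htouch hle b (-s)
  rw [sum_dirDeriv₄_eq hG hJ hu hΩ huJ heq hx b, sum_dirDeriv₃_eq hG hJ hu hΩ huJ heq hx b,
    ← laplacian_eq_sum_dirDeriv hu hΩ hx b, heq x hx, htouch] at h
  have hsG : s * G (u x) = deriv G (u x) * dirDeriv e u x := div_mul_cancel₀ _ hG₀.ne'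
  have h1 : 0 ≤ 2 * n * (-s) ^ 2 * φ x := by positivity
  have h2 : deriv G (u x) * φ x ≤ 0 := mul_nonpos_of_nonpos_of_nonneg hG₁.le hφ₀
  have hn2 : (n : ℝ) / (n - 1) ≤ 2 := by
    have : (2 : ℝ) ≤ n := by exact_mod_cast hn
    rw [div_le_iff₀ (by linarith)]
    linarith
  have h3 : deriv (deriv G) (u x) * (dirDeriv e u x * dirDeriv e u x) ≤ 2 * s ^ 2 * G (u x) := by
    have h4 : G (u x) * deriv (deriv G) (u x) ≤ 2 * deriv G (u x) ^ 2 :=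
      hG₂.trans (mul_le_mul_of_nonneg_right hn2 (sq_nonneg _))
    have h5 := mul_le_mul_of_nonneg_right h4 (sq_nonneg (dirDeriv e u x))
    refine le_of_mul_le_mul_left ?_ hG₀
    calc _ = G (u x) * deriv (deriv G) (u x) * dirDeriv e u x ^ 2 := by ring
      _ ≤ 2 * deriv G (u x) ^ 2 * dirDeriv e u x ^ 2 := h5
      _ = 2 * (s * G (u x)) ^ 2 := by rw [hsG]; ring
      _ = _ := by ring
  have h6 : 4 * -s * (deriv G (u x) * dirDeriv e u x) = - (4 * s ^ 2 * G (u x)) := by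
    rw [← hsG]
    ring
  have h7 : 2 * (-s) ^ 2 * G (u x) = 2 * s ^ 2 * G (u x) := by ring
  rw [h6, h7] at h
  linarith

/-! ### The strong minimum principle -/

section Gaussian

open scoped RealInnerProductSpace

variable {n : ℕ} (ε α κ : ℝ) (c : EuclideanSpace ℝ (Fin n))

theorem contDiff_gaussian :
    ContDiff ℝ ∞ fun x : EuclideanSpace ℝ (Fin n) => ε * Real.exp (-α * ‖x - c‖ ^ 2) + κ := by
  have : ContDiff ℝ ∞ fun x : EuclideanSpace ℝ (Fin n) => ‖x - c‖ ^ 2 :=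
    (contDiff_id.sub contDiff_const).norm_sq ℝ
  fun_prop

theorem hasFDerivAt_exp_norm_sq (x : EuclideanSpace ℝ (Fin n)) :
    HasFDerivAt (fun x : EuclideanSpace ℝ (Fin n) => Real.exp (-α * ‖x - c‖ ^ 2))
      (Real.exp (-α * ‖x - c‖ ^ 2) • -α • (2 : ℕ) • innerSL ℝ (x - c)) x := by
  have h := ((hasFDerivAt_id x).sub_const c).norm_sq
  simpa using (h.const_mul (-α)).exp

theorem dirDeriv_gaussian (x v : EuclideanSpace ℝ (Fin n)) :
    dirDeriv v (fun x => ε * Real.exp (-α * ‖x - c‖ ^ 2) + κ) x =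
      ε * (-2 * α * ⟪x - c, v⟫ * Real.exp (-α * ‖x - c‖ ^ 2)) := by
  have h := ((hasFDerivAt_exp_norm_sq α c x).const_mul ε).add_const κ
  rw [dirDeriv, h.fderiv]
  simp only [_root_.smul_apply, smul_eq_mul, nsmul_eq_mul, innerSL_apply_apply]
  push_cast
  ring

theorem dirDeriv_dirDeriv_gaussian (x v : EuclideanSpace ℝ (Fin n)) :
    dirDeriv v (dirDeriv v fun x => ε * Real.exp (-α * ‖x - c‖ ^ 2) + κ) x =
      ε * ((4 * α ^ 2 * ⟪x - c, v⟫ ^ 2 - 2 * α * ‖v‖ ^ 2) * Real.exp (-α * ‖x - c‖ ^ 2)) := by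
  have h1 : (dirDeriv v fun x => ε * Real.exp (-α * ‖x - c‖ ^ 2) + κ) =
      fun x => ε * (-2 * α * ⟪x - c, v⟫ * Real.exp (-α * ‖x - c‖ ^ 2)) :=
    funext fun x => dirDeriv_gaussian ε α κ c x v
  have h2 : HasFDerivAt (fun x : EuclideanSpace ℝ (Fin n) => ⟪x - c, v⟫) (innerSL ℝ v) x := by
    simpa only [real_inner_comm] using! ((innerSL ℝ v).hasFDerivAt (x := x - c)).comp x
      ((hasFDerivAt_id x).sub_const c)
  have h3 : HasFDerivAt
      (fun x => ε * (-2 * α * ⟪x - c, v⟫ * Real.exp (-α * ‖x - c‖ ^ 2))) _ x :=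
    ((h2.const_mul (-2 * α)).mul (hasFDerivAt_exp_norm_sq α c x)).const_mul ε
  rw [h1, dirDeriv, h3.fderiv]
  simp only [_root_.smul_apply, _root_.add_apply, smul_eq_mul, nsmul_eq_mul, innerSL_apply_apply,
    real_inner_self_eq_norm_sq]
  push_cast
  ring

theorem sum_dirDeriv_dirDeriv_gaussian (x : EuclideanSpace ℝ (Fin n))
    (b : OrthonormalBasis (Fin n) ℝ (EuclideanSpace ℝ (Fin n))) :
    ∑ k, dirDeriv (b k) (dirDeriv (b k) fun x => ε * Real.exp (-α * ‖x - c‖ ^ 2) + κ) x =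
      ε * ((4 * α ^ 2 * ‖x - c‖ ^ 2 - 2 * α * n) * Real.exp (-α * ‖x - c‖ ^ 2)) := by
  simp only [dirDeriv_dirDeriv_gaussian, b.norm_eq_one, ← Finset.mul_sum, ← Finset.sum_mul,
    Finset.sum_sub_distrib]
  rw [b.sum_sq_inner_left]
  simp

end Gaussian

/-- If a zero set meets a connected open set without filling it, then some closed ball inside the
open set meets it in exactly one point, which lies on the bounding sphere. -/
theorem exists_closedBall_touching {n : ℕ} {Ω : Set (EuclideanSpace ℝ (Fin n))} (hΩ : IsOpen Ω)
    (hconn : IsPreconnected Ω) {f : EuclideanSpace ℝ (Fin n) → ℝ} (hf : ContinuousOn f Ω)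
    {p q : EuclideanSpace ℝ (Fin n)} (hp : p ∈ Ω) (hfp : f p = 0) (hq : q ∈ Ω) (hfq : f q ≠ 0) :
    ∃ (c x₀ : EuclideanSpace ℝ (Fin n)) (R : ℝ), 0 < R ∧ Metric.closedBall c R ⊆ Ω ∧
      ‖x₀ - c‖ = R ∧ f x₀ = 0 ∧ ∀ y ∈ Metric.closedBall c R, f y = 0 → y = x₀ := by
  set U := Ω ∩ f ⁻¹' {0}ᶜ with hU
  have hUo : IsOpen U := hf.isOpen_inter_preimage hΩ isOpen_compl_singleton
  obtain ⟨z, hz, hfz, hzU⟩ : ∃ z ∈ Ω, f z = 0 ∧ z ∈ closure U := by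
    by_contra! hcon
    obtain ⟨y, -, hyU, hyV⟩ := hconn U (closure U)ᶜ hUo isClosed_closure.isOpen_compl
      (fun y hy => by
        by_cases h : f y = 0
        · exact Or.inr (hcon y hy h)
        · exact Or.inl ⟨hy, h⟩)
      ⟨q, hq, hq, hfq⟩ ⟨p, hp, hcon p hp hfp⟩
    exact hyV (subset_closure hyU)
  obtain ⟨ε, hε, hball⟩ := Metric.isOpen_iff.1 hΩ z hz
  obtain ⟨c, ⟨hcΩ, hfc⟩, hcz⟩ := Metric.mem_closure_iff.1 hzU (ε / 3) (by linarith)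
  have hsub : Metric.closedBall z (2 * (ε / 3)) ⊆ Ω :=
    (Metric.closedBall_subset_ball (by linarith)).trans hball
  have hK : IsCompact (Metric.closedBall z (2 * (ε / 3)) ∩ f ⁻¹' {0}) :=
    (isCompact_closedBall _ _).of_isClosed_subset
      ((hf.mono hsub).preimage_isClosed_of_isClosed Metric.isClosed_closedBall isClosed_singleton)
      Set.inter_subset_left
  obtain ⟨x₀, ⟨hx₀, hfx₀⟩, hmin⟩ := hK.exists_isMinOn (f := fun y => dist y c)
    ⟨z, Metric.mem_closedBall_self (by linarith), hfz⟩ (by fun_prop)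
  have hd1 : dist x₀ c ≤ dist z c := hmin ⟨Metric.mem_closedBall_self (by linarith), hfz⟩
  have hd0 : 0 < dist x₀ c := dist_pos.2 fun h => hfc (h ▸ hfx₀)
  -- Halving the ball towards `x₀` makes the point of contact unique.
  refine ⟨midpoint ℝ c x₀, x₀, dist x₀ c / 2, by linarith, ?_, ?_, hfx₀, ?_⟩
  · intro y hy
    refine hsub ?_
    rw [Metric.mem_closedBall] at hy ⊢
    have h1 : dist (midpoint ℝ c x₀) c = dist x₀ c / 2 := by
      rw [dist_midpoint_left, dist_comm c x₀]
      norm_num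
      ring
    have h2 := dist_triangle y (midpoint ℝ c x₀) c
    have h3 := dist_triangle y c z
    have h4 := dist_comm z c
    linarith
  · rw [← dist_eq_norm, dist_right_midpoint, dist_comm c x₀]
    norm_num
    ring
  · intro y hy hfy
    set a := y - midpoint ℝ c x₀ with ha
    set w := (1 / 2 : ℝ) • (x₀ - c) with hw
    have hyc : y - c = a + w := by
      rw [ha, hw, midpoint_eq_smul_add, invOf_eq_inv]
      module
    have hyx : y - x₀ = a - w := by
      rw [ha, hw, midpoint_eq_smul_add, invOf_eq_inv]
      module
    have haR : ‖a‖ ≤ dist x₀ c / 2 := mem_closedBall_iff_norm.1 hy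
    have hwR : ‖w‖ = dist x₀ c / 2 := by
      rw [hw, norm_smul, ← dist_eq_norm]
      norm_num
      ring
    have hyz : dist y z ≤ 2 * (ε / 3) := by
      have h1 := norm_add_le a w
      rw [← hyc, ← dist_eq_norm] at h1
      have h2 := dist_triangle y c z
      have h3 := dist_comm z c
      linarith
    have hdy : dist x₀ c ≤ ‖a + w‖ := by
      rw [← hyc, ← dist_eq_norm]
      exact hmin ⟨hyz, hfy⟩
    have hpar := parallelogram_law_with_norm ℝ a w
    have h1 : dist x₀ c * dist x₀ c ≤ ‖a + w‖ * ‖a + w‖ := by gcongr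
    have h2 : ‖a‖ * ‖a‖ ≤ dist x₀ c / 2 * (dist x₀ c / 2) := by gcongr
    rw [hwR] at hpar
    have h3 : ‖a - w‖ * ‖a - w‖ ≤ 0 := by linarith
    have h4 : ‖a - w‖ = 0 := mul_self_eq_zero.1 (le_antisymm h3 (mul_self_nonneg _))
    rwa [norm_eq_zero, ← hyx, sub_eq_zero] at h4

/-- Hopf's argument for the least eigenvalue of the Hessian: the set where it vanishes cannot
touch a ball contained in `Ω` at a single boundary point. -/
theorem not_touching_closedBall {n : ℕ} (hn : 2 ≤ n)
    {Ω : Set (EuclideanSpace ℝ (Fin n))} (hΩ : IsOpen Ω) {J : Set ℝ} (hJ : IsOpen J) {G : ℝ → ℝ}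
    (hG : ContDiffOn ℝ ∞ G J) {u : EuclideanSpace ℝ (Fin n) → ℝ} (hu : ContDiffOn ℝ ∞ u Ω)
    (huJ : ∀ x ∈ Ω, u x ∈ J) (hc : IsConvexFunctionOn Ω u)
    (heq : ∀ x ∈ Ω, Laplacian.laplacian u x = G (u x))
    (hG₀ : ∀ x ∈ Ω, 0 < G (u x)) (hG₁ : ∀ x ∈ Ω, deriv G (u x) < 0)
    (hG₂ : ∀ x ∈ Ω,
      G (u x) * deriv (deriv G) (u x) ≤ (n : ℝ) / (n - 1) * deriv G (u x) ^ 2)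
    {c x₀ : EuclideanSpace ℝ (Fin n)} {R : ℝ} (hR : 0 < R) (hball : Metric.closedBall c R ⊆ Ω)
    (hx₀ : ‖x₀ - c‖ = R) (hzero : (hessianMatrix u x₀).det = 0) :
    ¬ ∀ y ∈ Metric.closedBall c R, (hessianMatrix u y).det = 0 → y = x₀ := by
  intro huniq
  have hx₀Ω : x₀ ∈ Ω := hball (by rw [mem_closedBall_iff_norm, hx₀])
  obtain ⟨e₀, he₀, hQ₀⟩ := (hc.det_hessianMatrix_eq_zero_iff hu hΩ hx₀Ω).1 hzero
  -- A ball around `x₀` in `Ω` that stays away from `c`.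
  obtain ⟨ρ, hρ, hρR, hρΩ⟩ : ∃ ρ, 0 < ρ ∧ ρ ≤ R / 2 ∧ Metric.closedBall x₀ ρ ⊆ Ω := by
    obtain ⟨r, hr, h⟩ := Metric.nhds_basis_closedBall.mem_iff.1 (hΩ.mem_nhds hx₀Ω)
    exact ⟨min r (R / 2), lt_min hr (by linarith), min_le_right _ _,
      (Metric.closedBall_subset_closedBall (min_le_left _ _)).trans h⟩
  have hfd : ContinuousOn (fderiv ℝ u) Ω := hu.continuousOn_fderiv_of_isOpen hΩ (by simp)
  have hfdd : ContinuousOn (fderiv ℝ (fderiv ℝ u)) Ω :=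
    (hu.fderiv_of_isOpen hΩ (m := ∞) (by simp)).continuousOn_fderiv_of_isOpen hΩ (by simp)
  have hQeq : ∀ x ∈ Ω, ∀ v, fderiv ℝ (fderiv ℝ u) x v v = dirDeriv v (dirDeriv v u) x :=
    fun x hx v => (dirDeriv_dirDeriv_eq_fderiv_fderiv hu hΩ hx v v).symm
  have hQcont : ContinuousOn (fun z : EuclideanSpace ℝ (Fin n) × EuclideanSpace ℝ (Fin n) =>
      fderiv ℝ (fderiv ℝ u) z.1 z.2 z.2) (Ω ×ˢ Set.univ) := by
    have h1 : ContinuousOn (fun z : EuclideanSpace ℝ (Fin n) × EuclideanSpace ℝ (Fin n) =>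
        fderiv ℝ (fderiv ℝ u) z.1) (Ω ×ˢ Set.univ) :=
      hfdd.comp continuousOn_fst fun z hz => hz.1
    exact (h1.clm_apply continuousOn_snd).clm_apply continuousOn_snd
  -- A bound for the first-order coefficient in the inequality for the least eigenvalue.
  obtain ⟨C, hC⟩ : ∃ C, ∀ x ∈ Metric.closedBall x₀ ρ, ∀ e : EuclideanSpace ℝ (Fin n), ‖e‖ = 1 →
      |4 * (deriv G (u x) * dirDeriv e u x / G (u x))| ≤ C := by
    have hG' : ContinuousOn (fun x => deriv G (u x)) Ω :=
      (hG.continuousOn_deriv_of_isOpen hJ (by simp)).comp hu.continuousOn huJ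
    have hGu : ContinuousOn (fun x => G (u x)) Ω := hG.continuousOn.comp hu.continuousOn huJ
    have hcont : ContinuousOn (fun x => 4 * (deriv G (u x) * ‖fderiv ℝ u x‖ / G (u x))) Ω :=
      continuousOn_const.mul ((hG'.mul hfd.norm).div hGu fun x hx => (hG₀ x hx).ne')
    obtain ⟨C, hC⟩ := (isCompact_closedBall x₀ ρ).exists_bound_of_continuousOn (hcont.mono hρΩ)
    refine ⟨C, fun x hx e he => le_trans ?_ (hC x hx)⟩
    have h1 : |dirDeriv e u x| ≤ ‖fderiv ℝ u x‖ := by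
      simpa [he, dirDeriv] using (fderiv ℝ u x).le_opNorm e
    simp only [Real.norm_eq_abs, abs_mul, abs_div, abs_norm]
    gcongr
  have hC0 : 0 ≤ C := (abs_nonneg _).trans (hC x₀ (Metric.mem_closedBall_self hρ.le) e₀ he₀)
  -- The barrier `exp (-α |x - c|²) - exp (-α R²)`, with `α` so large that `2 α r² > n + C r`
  -- for `R / 2 ≤ r ≤ 2 R`.
  obtain ⟨α, hα, hαR⟩ : ∃ α : ℝ, 0 < α ∧ n + 2 * C * R < 2 * α * (R / 2) ^ 2 := by
    refine ⟨2 * (n + 2 * C * R + 1) / R ^ 2, by positivity, ?_⟩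
    have : 2 * (2 * (n + 2 * C * R + 1) / R ^ 2) * (R / 2) ^ 2 = n + 2 * C * R + 1 := by
      field_simp
    linarith
  set h : EuclideanSpace ℝ (Fin n) → ℝ :=
    fun x => Real.exp (-α * ‖x - c‖ ^ 2) - Real.exp (-α * R ^ 2) with hh
  have hcontF : Continuous h := by fun_prop
  have hh1 : ∀ x, h x ≤ 1 := by
    intro x
    have h1 : Real.exp (-α * ‖x - c‖ ^ 2) ≤ 1 := by
      rw [Real.exp_le_one_iff]
      have : 0 ≤ α * ‖x - c‖ ^ 2 := by positivity
      linarith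
    have h2 := Real.exp_pos (-α * R ^ 2)
    simp only [hh]
    linarith
  have hhneg : ∀ x ∉ Metric.closedBall c R, h x < 0 := by
    intro x hx
    rw [mem_closedBall_iff_norm, not_le] at hx
    simp only [hh, sub_neg, Real.exp_lt_exp]
    have : R ^ 2 < ‖x - c‖ ^ 2 := by gcongr
    have := mul_lt_mul_of_pos_left this hα
    linarith
  -- On the part of the small sphere that lies in the big ball, `D²u` is uniformly positive.
  obtain ⟨δ, hδ, hδQ⟩ : ∃ δ > 0, ∀ z ∈ (Metric.sphere x₀ ρ ∩ Metric.closedBall c R) ×ˢ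
      Metric.sphere (0 : EuclideanSpace ℝ (Fin n)) 1, δ ≤ fderiv ℝ (fderiv ℝ u) z.1 z.2 z.2 := by
    refine IsCompact.exists_forall_le' ?_ (hQcont.mono ?_) ?_
    · exact ((isCompact_sphere _ _).inter_right Metric.isClosed_closedBall).prod
        (isCompact_sphere _ _)
    · exact fun z hz => ⟨hball hz.1.2, trivial⟩
    · rintro ⟨x, e⟩ ⟨⟨hxs, hxb⟩, he⟩
      rw [hQeq x (hball hxb)]
      refine lt_of_le_of_ne (hc.dirDeriv_dirDeriv_nonneg hu hΩ (hball hxb) e) fun h0 => ?_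
      have := huniq x hxb ((hc.det_hessianMatrix_eq_zero_iff hu hΩ (hball hxb)).2
        ⟨e, by simpa using he, h0.symm⟩)
      rw [this, mem_sphere_iff_norm, sub_self, norm_zero] at hxs
      exact hρ.ne hxs
  -- Minimize `D²u(x)(e, e) - ε h(x)` over the small ball and all unit vectors `e`.
  set ε := δ / 2 with hε
  have hεpos : 0 < ε := by positivity
  obtain ⟨⟨x₁, e₁⟩, ⟨hx₁, he₁⟩, hmin⟩ := ((isCompact_closedBall x₀ ρ).prod
    (isCompact_sphere (0 : EuclideanSpace ℝ (Fin n)) 1)).exists_isMinOn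
    (f := fun z => fderiv ℝ (fderiv ℝ u) z.1 z.2 z.2 - ε * h z.1)
    ⟨(x₀, e₀), Metric.mem_closedBall_self hρ.le, by simpa using he₀⟩
    ((hQcont.mono fun z hz => ⟨hρΩ hz.1, trivial⟩).sub (by fun_prop))
  have hmin' : ∀ x ∈ Metric.closedBall x₀ ρ, ∀ e : EuclideanSpace ℝ (Fin n), ‖e‖ = 1 →
      fderiv ℝ (fderiv ℝ u) x₁ e₁ e₁ - ε * h x₁ ≤ fderiv ℝ (fderiv ℝ u) x e e - ε * h x :=
    fun x hx e he => hmin (Set.mk_mem_prod hx (by simpa using he))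
  simp only at hx₁ he₁
  have he₁' : ‖e₁‖ = 1 := by simpa using he₁
  have hx₁Ω := hρΩ hx₁
  have hQ₁ : 0 ≤ fderiv ℝ (fderiv ℝ u) x₁ e₁ e₁ := by
    rw [hQeq x₁ hx₁Ω]
    exact hc.dirDeriv_dirDeriv_nonneg hu hΩ hx₁Ω e₁
  set κ := fderiv ℝ (fderiv ℝ u) x₁ e₁ e₁ - ε * h x₁ with hκ
  have hκ0 : κ ≤ 0 := by
    have := hmin' x₀ (Metric.mem_closedBall_self hρ.le) e₀ he₀
    rw [hQeq x₀ hx₀Ω, hQ₀] at this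
    simpa [hh, hx₀] using this
  -- The minimum is not on the boundary of the small ball.
  have hx₁int : x₁ ∈ Metric.ball x₀ ρ := by
    refine lt_of_le_of_ne (Metric.mem_closedBall.1 hx₁) fun hsph => ?_
    by_cases hb : x₁ ∈ Metric.closedBall c R
    · have h1 := hδQ (x₁, e₁) ⟨⟨hsph, hb⟩, he₁⟩
      have h2 := mul_le_mul_of_nonneg_left (hh1 x₁) hεpos.le
      simp only at h1
      linarith
    · have := mul_neg_of_pos_of_neg hεpos (hhneg x₁ hb)
      linarith
  -- So the least eigenvalue is touched from below at `x₁` by `φ = ε h + κ`.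
  set κ' := κ - ε * Real.exp (-α * R ^ 2) with hκ'
  have hφh : ∀ x, ε * Real.exp (-α * ‖x - c‖ ^ 2) + κ' = ε * h x + κ := fun x => by
    simp only [hh, hκ']
    ring
  have hle : ∀ᶠ y in nhds x₁, ∀ v,
      (ε * Real.exp (-α * ‖y - c‖ ^ 2) + κ') * ‖v‖ ^ 2 ≤ dirDeriv v (dirDeriv v u) y := by
    filter_upwards [Metric.isOpen_ball.mem_nhds hx₁int] with y hy v
    have hyb := Metric.ball_subset_closedBall hy
    rw [hφh, ← hQeq y (hρΩ hyb)]
    by_cases hv : v = 0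
    · simp [hv]
    · have hv' : ‖v‖ ≠ 0 := norm_ne_zero_iff.2 hv
      have h1 := hmin' y hyb (‖v‖⁻¹ • v) (by
        rw [norm_smul, norm_inv, norm_norm, inv_mul_cancel₀ hv'])
      simp only [map_smul, _root_.smul_apply, smul_eq_mul] at h1
      have h2 : ε * h y + κ ≤ ‖v‖⁻¹ * (‖v‖⁻¹ * fderiv ℝ (fderiv ℝ u) y v v) := by linarith
      calc (ε * h y + κ) * ‖v‖ ^ 2
          ≤ ‖v‖⁻¹ * (‖v‖⁻¹ * fderiv ℝ (fderiv ℝ u) y v v) * ‖v‖ ^ 2 := by gcongr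
        _ = fderiv ℝ (fderiv ℝ u) y v v := by field_simp
  have hφ₁ : ε * Real.exp (-α * ‖x₁ - c‖ ^ 2) + κ' = fderiv ℝ (fderiv ℝ u) x₁ e₁ e₁ := by
    rw [hφh, hκ]
    ring
  have hfinal := laplacian_testFunction_le hn hΩ hJ hG hu huJ heq
    (contDiff_gaussian ε α κ' c).contDiffOn hx₁Ω (hG₀ x₁ hx₁Ω) (hG₁ x₁ hx₁Ω) (hG₂ x₁ hx₁Ω) he₁'
    ((hQeq x₁ hx₁Ω e₁).symm.trans hφ₁.symm) (hQ₁.trans_eq hφ₁.symm) hle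
    (EuclideanSpace.basisFun (Fin n) ℝ)
  rw [sum_dirDeriv_dirDeriv_gaussian, dirDeriv_gaussian] at hfinal
  set r := ‖x₁ - c‖ with hr
  have hxx : ‖x₁ - x₀‖ ≤ R / 2 := (mem_closedBall_iff_norm.1 hx₁).trans hρR
  have hr1 : R / 2 ≤ r := by
    have h1 := norm_sub_le_norm_sub_add_norm_sub x₀ x₁ c
    rw [norm_sub_rev x₀ x₁, hx₀] at h1
    linarith
  have hr2 : r ≤ 2 * R := by
    have h1 := norm_sub_le_norm_sub_add_norm_sub x₁ x₀ c
    rw [hx₀] at h1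
    linarith
  have hr0 : 0 < r := by linarith
  set E := Real.exp (-α * r ^ 2)
  have hE : 0 < E := Real.exp_pos _
  set B := 4 * (deriv G (u x₁) * dirDeriv e₁ u x₁ / G (u x₁))
  have hB : |B| ≤ C := hC x₁ hx₁ e₁ he₁'
  have hin : |inner ℝ (x₁ - c) e₁| ≤ r := by
    simpa [he₁'] using abs_real_inner_le_norm (x₁ - c) e₁
  have h1 : -(B * inner ℝ (x₁ - c) e₁) ≤ C * r :=
    (neg_le_abs _).trans (by rw [abs_mul]; gcongr)
  have h2 : C * r ≤ 2 * C * R := by nlinarith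
  have h3 : 2 * α * (R / 2) ^ 2 ≤ 2 * α * r ^ 2 := by gcongr
  have h4 : 0 < 2 * α * ε * E * (2 * α * r ^ 2 - n + B * inner ℝ (x₁ - c) e₁) :=
    mul_pos (by positivity) (by linarith)
  linarith

theorem continuousOn_det_hessianMatrix {n : ℕ} {Ω : Set (EuclideanSpace ℝ (Fin n))}
    (hΩ : IsOpen Ω) {u : EuclideanSpace ℝ (Fin n) → ℝ} (hu : ContDiffOn ℝ ∞ u Ω) :
    ContinuousOn (fun x => (hessianMatrix u x).det) Ω := by
  have hent : ContinuousOn (hessianMatrix u) Ω := by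
    refine continuousOn_pi.2 fun i => continuousOn_pi.2 fun j => ?_
    refine (contDiffOn_dirDeriv (contDiffOn_dirDeriv hu hΩ (EuclideanSpace.single j 1)) hΩ
      (EuclideanSpace.single i 1)).continuousOn.congr fun x hx => ?_
    exact iteratedFDeriv_two_eq_dirDeriv hu hΩ hx _ _
  exact continuous_id.matrix_det.comp_continuousOn hent

theorem theorem3 (n : ℕ) (hn : 2 ≤ n)
    (Ω : Set (EuclideanSpace ℝ (Fin n))) (hΩ_open : IsOpen Ω) (hΩ_conn : IsConnected Ω)
    (J : Set ℝ) (hJ : IsOpen J) (G : ℝ → ℝ) (hG_smooth : ContDiffOn ℝ ∞ G J)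
    (u : EuclideanSpace ℝ (Fin n) → ℝ) (hu_smooth : ContDiffOn ℝ ∞ u Ω)
    (huJ : ∀ x ∈ Ω, u x ∈ J)
    (hu_convex : IsConvexFunctionOn Ω u)
    (hu_eq : ∀ x ∈ Ω, Laplacian.laplacian u x = G (u x))
    (hG_pos : ∀ x ∈ Ω, 0 < G (u x))
    (hG_deriv : ∀ x ∈ Ω, deriv G (u x) < 0)
    (hG_second : ∀ x ∈ Ω,
      G (u x) * deriv (deriv G) (u x) ≤ (n : ℝ) / ((n : ℝ) - 1) * (deriv G (u x)) ^ 2)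
    (hmin : ∃ p ∈ Ω, IsLocalMin (fun x => (hessianMatrix u x).det) p) :
    ∀ x ∈ Ω, (hessianMatrix u x).det = 0 := by
  obtain ⟨p, hp, hpmin⟩ := hmin
  have hdetp := det_hessianMatrix_eq_zero_of_isLocalMin hn hΩ_open hJ hG_smooth hu_smooth huJ
    hu_convex hu_eq hp (hG_pos p hp) (hG_deriv p hp) (hG_second p hp) hpmin
  intro q hq
  by_contra hdetq
  obtain ⟨c, x₀, R, hR, hball, hx₀, hzero, huniq⟩ := exists_closedBall_touching hΩ_open
    hΩ_conn.isPreconnected (continuousOn_det_hessianMatrix hΩ_open hu_smooth) hp hdetp hq hdetq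
  exact not_touching_closedBall hn hΩ_open hJ hG_smooth hu_smooth huJ hu_convex hu_eq hG_pos
    hG_deriv hG_second hR hball hx₀ hzero huniq
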